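/- **Conventions.** Let $G$ be a finite group. For $X\subseteq G$ put $\underline{X}=\sum_{x\in X}x\in\mathbb{Z}G$ and $\mathrm{rad}(X)=\{g\in G: gX=Xg=X\}$. An *S-ring* over $G$ is a subring $\mathcal{A}$ of $\mathbb{Z}G$ which is the $\mathbb{Z}$-span of the elements $\underline{X}$, $X\in\mathcal{S}(\mathcal{A})$, for a partition $\mathcal{S}(\mathcal{A})$ of $G$ that has $\{1\}$ as a class and is closed under taking inverses; the classes are the *basic sets* of $\mathcal{A}$. The *trivial* S-ring $\mathcal{T}_G$ is the one whose basic sets are $\{1\}$ and (if nonempty) $G\setminus\{1\}$; $\mathcal{A}$ is *nontrivial* if $\mathcal{A}\neq\mathcal{T}_G$. A subgroup $U\le G$ is an *$\mathcal{A}$-subgroup* if $\underline{U}\in\mathcal{A}$. If $U$ is an $\mathcal{A}$-subgroup, $\mathcal{A}_U$ is the S-ring over $U$ whose basic sets are the basic sets of $\mathcal{A}$ contained in $U$; if moreover $L$ is a normal $\mathcal{A}$-subgroup of $G$, $\mathcal{A}_{G/L}$ is the S-ring over $G/L$ whose basic sets are the images of the basic sets of $\mathcal{A}$. Let $L,U,V,W$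 be $\mathcal{A}$-subgroups. - If $L\le U$ and $L\trianglelefteq G$, then $\mathcal{A}$ is the *$U/L$-wreath product* if $L\le\mathrm{rad}(X)$ for every basic set $X\subseteq G\setminus U$; it is the *nontrivial* $U/L$-wreath product if, in addition, $L\ne 1$ and $U\neq G$. One writes $\mathcal{A}=\mathcal{A}_U\wr\mathcal{A}_{G/U}$ if $\mathcal{A}$ is the $U/U$-wreath product. - $\mathcal{A}=\mathcal{A}_V\star\mathcal{A}_W$ (*star product*) if $V\cap W\trianglelefteq W$, every basic set contained in $W\setminus V$ is a union of cosets of $V\cap W$, and every basic set contained in $G\setminus(V\cup W)$ equals $RS$ for some $R\in\mathcal{S}(\mathcal{A}_V)$ and $S\in\mathcal{S}(\mathcal{A}_W)$. - $\mathcal{A}=\mathcal{A}_U\otimes\mathcal{A}_V$ if $G=U\times V$ and $\mathcal{S}(\mathcal{A})=\{RS: R\in\mathcal{S}(\mathcal{A}_U),\ S\in\mathcal{S}(\mathcal{A}_V)\}$. $\mathcal{A}_U$ is *$\otimes$-complemented* in $\mathcal{A}$ if $\mathcal{A}=\mathcal{A}_U\otimes\mathcal{A}_V$ for some $\mathcal{A}$-subgroup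 $V$. **Theorem.** Let $G\cong C_6\times C_{3^k}$ for some integer $k\ge 1$, or $G\cong E_9\times C_{2q}$ for some odd prime $q$, where $C_n$ is the cyclic group of order $n$ and $E_9=C_3\times C_3$. Write $G=H\times P$, where $H$ is the Hall $2'$-subgroup of $G$ and $P\cong C_2$. Let $\mathcal{A}$ be a nontrivial S-ring over $G$, let $H_1$ be a maximal $\mathcal{A}$-subgroup contained in $H$, and let $P_1$ be the least $\mathcal{A}$-subgroup containing $P$. Then one of the following statements holds: 1. $H_1P_1=G$, $|H_1|>1$, and $\mathcal{A}=\mathcal{A}_{H_1}\star\mathcal{A}_{P_1}$; 2. $|H_1|>1$ and $\mathcal{A}=\mathcal{A}_{H_1}\wr\mathcal{T}_{G/H_1}$, that is, $\mathcal{A}$ is the $H_1/H_1$-wreath product and $\mathcal{A}_{G/H_1}=\mathcal{T}_{G/H_1}$; 3. $\mathcal{A}$ is the nontrivial $(H_1P_1)/P_1$-wreath product and $\mathcal{A}_{P_1}$ is $\otimes$-complemented in $\mathcal{A}_{H_1P_1}$; 4. $\mathcal{A}$ is both the nontrivial $(H_1P_1)/P_1$-wreath product and the nontrivial $H_1/(H_1\cap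 P_1)$-wreath product. -/

import Mathlib

open scoped Pointwise

noncomputable section

/-- The element `∑_{x ∈ X} x` of the integral group ring `ℤG`. -/
def simpleQuantity {G : Type*} [Group G] [Finite G] (X : Set G) : MonoidAlgebra ℤ G :=
  ∑ g ∈ X.toFinite.toFinset, MonoidAlgebra.single g 1

/-- An S-ring over a finite group `G`: a subring of `ℤG` which is spanned, as a `ℤ`-module, by the
elements `∑_{x ∈ X} x`, where `X` runs over the classes (the *basic sets*) of a partition of `G`
which is closed under inversion and has `{1}` as a class. -/
structure SchurRing (G : Type*) [Group G] [Finite G] where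
  toSubring : Subring (MonoidAlgebra ℤ G)
  basicSets : Set (Set G)
  isPartition : Setoid.IsPartition basicSets
  one_mem : {1} ∈ basicSets
  inv_mem : ∀ X ∈ basicSets, X⁻¹ ∈ basicSets
  span_eq : (toSubring : Set (MonoidAlgebra ℤ G)) =
    Submodule.span ℤ (simpleQuantity '' basicSets)

section Aux

variable {G : Type*} [Group G] [Finite G]

theorem coeff_simpleQuantity (X : Set G) [DecidablePred (· ∈ X)] (z : G) :
    (simpleQuantity X).coeff z = if z ∈ X then 1 else 0 := by
  classical
  simp [simpleQuantity, MonoidAlgebra.coeff_sum, Finsupp.single_apply]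

theorem simpleQuantity_one : simpleQuantity ({1} : Set G) = 1 := by
  have : ({1} : Set G).toFinite.toFinset = {1} := by
    ext; simp
  rw [simpleQuantity, this, Finset.sum_singleton, MonoidAlgebra.one_def]

theorem coeff_mul_simpleQuantity (f : MonoidAlgebra ℤ G) (Y : Set G) (z : G) :
    (f * simpleQuantity Y).coeff z = ∑ g ∈ Y.toFinite.toFinset, f.coeff (z * g⁻¹) := by
  simp [simpleQuantity, Finset.mul_sum, MonoidAlgebra.coeff_sum]

/-- The span of a partition consists of the elements with coefficients constant on its classes. -/
theorem mem_span_iff_of_isPartition {P : Set (Set G)} (hP : Setoid.IsPartition P)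
    (f : MonoidAlgebra ℤ G) :
    f ∈ Submodule.span ℤ (simpleQuantity '' P) ↔
      ∀ X ∈ P, ∀ x ∈ X, ∀ y ∈ X, f.coeff x = f.coeff y := by
  classical
  constructor
  · intro hf
    induction hf using Submodule.span_induction with
    | mem f hf =>
      obtain ⟨Y, hY, rfl⟩ := hf
      intro X hX x hx y hy
      rw [coeff_simpleQuantity, coeff_simpleQuantity]
      have key : ∀ a ∈ X, ∀ b ∈ X, a ∈ Y → b ∈ Y := by
        intro a ha b hb haY
        rwa [← (hP.2 a).unique ⟨hX, ha⟩ ⟨hY, haY⟩]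
      simp only [show x ∈ Y ↔ y ∈ Y from ⟨key x hx y hy, key y hy x hx⟩]
    | zero => simp
    | add f g _ _ h1 h2 =>
      intro X hX x hx y hy
      simp [h1 X hX x hx y hy, h2 X hX x hx y hy]
    | smul a f _ h =>
      intro X hX x hx y hy
      rw [MonoidAlgebra.coeff_smul, Finsupp.smul_apply, Finsupp.smul_apply, h X hX x hx y hy]
  · intro h
    have hne : ∀ X ∈ P, X.Nonempty := fun X hX => Setoid.nonempty_of_mem_partition hP hX
    choose! r hr using hne
    have : f = ∑ X ∈ P.toFinite.toFinset, f.coeff (r X) • simpleQuantity X := by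
      ext z
      obtain ⟨Z, ⟨hZ, hz⟩, huniq⟩ := hP.2 z
      rw [MonoidAlgebra.coeff_sum, Finsupp.finsetSum_apply, Finset.sum_eq_single Z]
      · rw [MonoidAlgebra.coeff_smul, Finsupp.smul_apply, coeff_simpleQuantity, if_pos hz,
          h Z hZ z hz (r Z) (hr Z hZ), smul_eq_mul, mul_one]
      · intro Y hY hYZ
        have : z ∉ Y := fun hzY => hYZ (huniq Y ⟨by simpa using hY, hzY⟩)
        rw [MonoidAlgebra.coeff_smul, Finsupp.smul_apply, coeff_simpleQuantity, if_neg this,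
          smul_zero]
      · intro hn
        simp [hZ] at hn
    rw [this]
    refine Submodule.sum_mem _ fun X hX => Submodule.smul_mem _ _ (Submodule.subset_span ?_)
    exact ⟨X, by simpa using hX, rfl⟩

end Aux

namespace SchurRing

/-- The S-ring spanned by a partition whose span is closed under multiplication. -/
def ofPartition {G : Type*} [Group G] [Finite G] (P : Set (Set G)) (hP : Setoid.IsPartition P)
    (h1 : {1} ∈ P) (hinv : ∀ X ∈ P, X⁻¹ ∈ P)
    (hmul : ∀ X ∈ P, ∀ Y ∈ P,
      simpleQuantity X * simpleQuantity Y ∈ Submodule.span ℤ (simpleQuantity '' P)) :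
    SchurRing G where
  toSubring := ((Submodule.span ℤ (simpleQuantity '' P)).toSubalgebra
    (by rw [← simpleQuantity_one]; exact Submodule.subset_span ⟨_, h1, rfl⟩)
    (by
      intro x y hx hy
      induction hx using Submodule.span_induction with
      | mem x hx =>
        obtain ⟨X, hX, rfl⟩ := hx
        induction hy using Submodule.span_induction with
        | mem y hy =>
          obtain ⟨Y, hY, rfl⟩ := hy
          exact hmul X hX Y hY
        | zero => simp
        | add f g _ _ h1 h2 => rw [mul_add]; exact Submodule.add_mem _ h1 h2
        | smul a f _ h => rw [mul_smul_comm]; exact Submodule.smul_mem _ _ h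
      | zero => simp
      | add f g _ _ h1 h2 => rw [add_mul]; exact Submodule.add_mem _ h1 h2
      | smul a f _ h => rw [smul_mul_assoc]; exact Submodule.smul_mem _ _ h)).toSubring
  basicSets := P
  isPartition := hP
  one_mem := h1
  inv_mem := hinv
  span_eq := rfl

section Basic

variable {G : Type*} [Group G] [Finite G] (A : SchurRing G)

theorem mem_iff (f : MonoidAlgebra ℤ G) : f ∈ A.toSubring ↔
    ∀ X ∈ A.basicSets, ∀ x ∈ X, ∀ y ∈ X, f.coeff x = f.coeff y := by
  rw [← mem_span_iff_of_isPartition A.isPartition, ← SetLike.mem_coe, A.span_eq,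
    SetLike.mem_coe]

theorem simpleQuantity_mem {X : Set G} (hX : X ∈ A.basicSets) :
    simpleQuantity X ∈ A.toSubring := by
  rw [← SetLike.mem_coe, A.span_eq]
  exact Submodule.subset_span ⟨X, hX, rfl⟩

/-- `X` is an `A`-set if `∑_{x ∈ X} x` belongs to `A`. -/
def IsASet (X : Set G) : Prop := simpleQuantity X ∈ A.toSubring

/-- A subgroup is an `A`-subgroup if it is an `A`-set. -/
def IsASubgroup (U : Subgroup G) : Prop := A.IsASet (U : Set G)

theorem IsASet.subset {A : SchurRing G} {T X : Set G} (hT : A.IsASet T) (hX : X ∈ A.basicSets)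
    {x : G} (hx : x ∈ X) (hxT : x ∈ T) : X ⊆ T := by
  classical
  intro y hy
  have h := (A.mem_iff _).1 hT X hX x hx y hy
  by_contra hyT
  simp [coeff_simpleQuantity, hxT, hyT] at h

/-- The set of all basic sets inside `T`. -/
def basicSetsIn (T : Set G) : Set (Set G) := {X | X ∈ A.basicSets ∧ X ⊆ T}

end Basic

/-- The trivial S-ring `T_G`, whose basic sets are `{1}` and, if it is nonempty, `G \ {1}`. -/
protected def trivial (G : Type*) [Group G] [Finite G] : SchurRing G :=
  ofPartition {X | X.Nonempty ∧ (X = {1} ∨ X = {1}ᶜ)}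
    (by
      refine ⟨by simp, fun a => ?_⟩
      by_cases ha : a = 1
      · refine ⟨{1}, ⟨⟨⟨1, rfl⟩, Or.inl rfl⟩, ha⟩, ?_⟩
        rintro Y ⟨⟨_, rfl | rfl⟩, haY⟩
        · rfl
        · exact absurd ha haY
      · refine ⟨{1}ᶜ, ⟨⟨⟨a, ha⟩, Or.inr rfl⟩, ha⟩, ?_⟩
        rintro Y ⟨⟨_, rfl | rfl⟩, haY⟩
        · exact absurd haY ha
        · rfl)
    ⟨⟨1, rfl⟩, Or.inl rfl⟩
    (by
      rintro X ⟨hne, rfl | rfl⟩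
      · exact ⟨hne.inv, Or.inl (by simp)⟩
      · exact ⟨hne.inv, Or.inr (by ext; simp)⟩)
    (by
      classical
      rintro X ⟨hX, rfl | rfl⟩ Y ⟨hY, rfl | rfl⟩
      · rw [simpleQuantity_one, one_mul, ← simpleQuantity_one]
        exact Submodule.subset_span ⟨_, ⟨hX, Or.inl rfl⟩, rfl⟩
      · rw [simpleQuantity_one, one_mul]
        exact Submodule.subset_span ⟨_, ⟨hY, Or.inr rfl⟩, rfl⟩
      · rw [simpleQuantity_one, mul_one]
        exact Submodule.subset_span ⟨_, ⟨hX, Or.inr rfl⟩, rfl⟩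
      · have h1 : simpleQuantity ({1} : Set G) ∈
            Submodule.span ℤ (simpleQuantity '' {X : Set G | X.Nonempty ∧ (X = {1} ∨ X = {1}ᶜ)}) :=
          Submodule.subset_span ⟨{1}, ⟨⟨1, rfl⟩, Or.inl rfl⟩, rfl⟩
        have h2 : simpleQuantity ({1}ᶜ : Set G) ∈
            Submodule.span ℤ (simpleQuantity '' {X : Set G | X.Nonempty ∧ (X = {1} ∨ X = {1}ᶜ)}) :=
          Submodule.subset_span ⟨_, ⟨hX, Or.inr rfl⟩, rfl⟩
        have hu : simpleQuantity (Set.univ : Set G) =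
            simpleQuantity ({1} : Set G) + simpleQuantity ({1}ᶜ : Set G) := by
          ext z
          by_cases hz : z = 1 <;> simp [coeff_simpleQuantity, hz]
        have huu : simpleQuantity (Set.univ : Set G) * simpleQuantity (Set.univ : Set G) =
            (Nat.card G : ℤ) • simpleQuantity (Set.univ : Set G) := by
          have := Fintype.ofFinite G
          ext z
          rw [coeff_mul_simpleQuantity, MonoidAlgebra.coeff_smul, Finsupp.smul_apply]
          simp [coeff_simpleQuantity]
        have hX' : simpleQuantity ({1}ᶜ : Set G) = simpleQuantity (Set.univ : Set G) - 1 := by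
          rw [hu, simpleQuantity_one]; abel
        have : simpleQuantity ({1}ᶜ : Set G) * simpleQuantity ({1}ᶜ : Set G) =
            ((Nat.card G : ℤ) - 2) • (simpleQuantity ({1} : Set G) + simpleQuantity ({1}ᶜ : Set G))
              + simpleQuantity ({1} : Set G) := by
          rw [← hu, hX', sub_mul, mul_sub, huu, sub_smul, simpleQuantity_one, two_smul]
          simp only [mul_one, one_mul]
          abel
        rw [this]
        exact Submodule.add_mem _ (Submodule.smul_mem _ _ (Submodule.add_mem _ h1 h2)) h1)

section Constructions

variable {G : Type*} [Group G] [Finite G] (A : SchurRing G)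

/-- The basic sets of `A` inside `U`, regarded as subsets of the group `U`. -/
def restrictBasicSets (U : Subgroup G) : Set (Set U) :=
  {Y | ((↑) '' Y : Set G) ∈ A.basicSets}

theorem isPartition_restrictBasicSets (U : Subgroup G) (hU : A.IsASubgroup U) :
    Setoid.IsPartition (A.restrictBasicSets U) := by
  constructor
  · intro h
    simp only [restrictBasicSets, Set.mem_ofPred_eq, Set.image_empty] at h
    exact A.isPartition.1 h
  · intro u
    obtain ⟨X, ⟨hX, hu⟩, huniq⟩ := A.isPartition.2 (u : G)
    have hXU : X ⊆ (U : Set G) := hU.subset hX hu u.2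
    have himg : ((↑) '' ((↑) ⁻¹' X : Set U) : Set G) = X := by
      rw [Set.image_preimage_eq_iff]
      simpa using hXU
    refine ⟨((↑) : U → G) ⁻¹' X, ⟨?_, hu⟩, ?_⟩
    · simpa only [restrictBasicSets, Set.mem_ofPred_eq, himg] using hX
    · rintro Y ⟨hY, huY⟩
      have := huniq _ ⟨hY, ⟨u, huY, rfl⟩⟩
      rw [← this, Set.preimage_image_eq _ Subtype.val_injective]

/-- The S-ring `A_U` over an `A`-subgroup `U`, whose basic sets are the basic sets of `A`
inside `U`. -/
def restrict (U : Subgroup G) (hU : A.IsASubgroup U) : SchurRing U :=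
  ofPartition (A.restrictBasicSets U) (A.isPartition_restrictBasicSets U hU)
    (by simpa [restrictBasicSets] using A.one_mem)
    (by
      intro X hX
      have := A.inv_mem _ hX
      simp only [restrictBasicSets, Set.mem_ofPred_eq]
      convert this using 1
      exact Set.image_inv U.subtype X)
    (by
      classical
      have hinj : Function.Injective (U.subtype : U → G) := Subtype.val_injective
      have hmap : ∀ X : Set U, MonoidAlgebra.mapDomainRingHom ℤ U.subtype (simpleQuantity X) =
          simpleQuantity ((↑) '' X : Set G) := by
        intro X
        have : ((↑) '' X : Set G).toFinite.toFinset =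
            X.toFinite.toFinset.image (Subtype.val : U → G) := by
          ext; simp
        simp only [simpleQuantity, map_sum, this]
        rw [Finset.sum_image (by intro a _ b _ h; exact Subtype.ext h)]
        simp
      have hcoeff : ∀ (f : MonoidAlgebra ℤ U) (u : U),
          (MonoidAlgebra.mapDomainRingHom ℤ U.subtype f).coeff u = f.coeff u := by
        intro f u
        exact Finsupp.mapDomain_apply hinj f.coeff u
      intro X hX Y hY
      rw [mem_span_iff_of_isPartition (A.isPartition_restrictBasicSets U hU)]
      intro Z hZ x hx y hy
      rw [← hcoeff, ← hcoeff, map_mul, hmap, hmap]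
      exact (A.mem_iff _).1 (A.toSubring.mul_mem (A.simpleQuantity_mem hX)
        (A.simpleQuantity_mem hY)) _ hZ _ ⟨x, hx, rfl⟩ _ ⟨y, hy, rfl⟩)

/-- The images in `G ⧸ L` of the basic sets of `A`. -/
def quotientBasicSets (L : Subgroup G) : Set (Set (G ⧸ L)) :=
  (fun X => ((↑) : G → G ⧸ L) '' X) '' A.basicSets

theorem coeff_mul_subgroup_eq_zero_iff (X : Set G) (L : Subgroup G) (z : G) :
    (simpleQuantity X * simpleQuantity (L : Set G)).coeff z = 0 ↔
      (z : G ⧸ L) ∉ ((↑) : G → G ⧸ L) '' X := by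
  classical
  rw [coeff_mul_simpleQuantity, Finset.sum_eq_zero_iff_of_nonneg
    (by intro i _; rw [coeff_simpleQuantity]; split_ifs <;> simp)]
  constructor
  · rintro h ⟨x, hx, hxz⟩
    have hl : x⁻¹ * z ∈ L := QuotientGroup.eq.1 hxz
    have := h (x⁻¹ * z) (by simpa using hl)
    simp [coeff_simpleQuantity, hx] at this
  · intro h l hl
    have hl' : l ∈ L := by simpa using hl
    rw [coeff_simpleQuantity, if_neg]
    intro hx
    exact h ⟨_, hx, QuotientGroup.eq.2 (by simpa using hl')⟩

theorem isPartition_quotientBasicSets (L : Subgroup G) (hL : A.IsASubgroup L) :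
    Setoid.IsPartition (A.quotientBasicSets L) := by
  have key : ∀ X ∈ A.basicSets, ∀ Y ∈ A.basicSets, ∀ y ∈ Y,
      (y : G ⧸ L) ∈ ((↑) : G → G ⧸ L) '' X →
      ((↑) : G → G ⧸ L) '' Y ⊆ ((↑) : G → G ⧸ L) '' X := by
    rintro X hX Y hY y hy hyX _ ⟨y', hy', rfl⟩
    have hmem := (A.mem_iff _).1 (A.toSubring.mul_mem (A.simpleQuantity_mem hX) hL) Y hY
      y hy y' hy'
    by_contra hcon
    rw [← coeff_mul_subgroup_eq_zero_iff, ← hmem, coeff_mul_subgroup_eq_zero_iff] at hcon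
    exact hcon hyX
  constructor
  · rintro ⟨X, hX, hXe⟩
    rw [Set.image_eq_empty] at hXe
    exact A.isPartition.1 (hXe ▸ hX)
  · intro a
    obtain ⟨g, rfl⟩ := QuotientGroup.mk_surjective a
    obtain ⟨X, ⟨hX, hg⟩, -⟩ := A.isPartition.2 g
    refine ⟨_, ⟨⟨X, hX, rfl⟩, ⟨g, hg, rfl⟩⟩, ?_⟩
    rintro _ ⟨⟨Y, hY, rfl⟩, hgY⟩
    refine Set.Subset.antisymm ?_ (key Y hY X hX g hg hgY)
    obtain ⟨y, hy, hyg⟩ := hgY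
    exact key X hX Y hY y hy ⟨g, hg, hyg.symm⟩

/-- The quotient S-ring `A_{G/L}` over `G ⧸ L` for a normal `A`-subgroup `L`, whose basic sets are
the images of the basic sets of `A`. -/
def quotient (L : Subgroup G) [L.Normal] (hL : A.IsASubgroup L) : SchurRing (G ⧸ L) :=
  ofPartition (A.quotientBasicSets L) (A.isPartition_quotientBasicSets L hL)
    ⟨{1}, A.one_mem, by simp⟩
    (by
      rintro _ ⟨X, hX, rfl⟩
      exact ⟨X⁻¹, A.inv_mem X hX, Set.image_inv (QuotientGroup.mk' L) X⟩)
    (by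
      classical
      have hcoeff : ∀ (f : MonoidAlgebra ℤ G) (z : G),
          (MonoidAlgebra.mapDomainRingHom ℤ (QuotientGroup.mk' L) f).coeff (z : G ⧸ L) =
            (f * simpleQuantity (L : Set G)).coeff z := by
        intro f z
        induction f using MonoidAlgebra.induction_linear with
        | zero => simp
        | add f g hf hg => simp only [map_add, add_mul, MonoidAlgebra.coeff_add,
            Finsupp.add_apply, hf, hg]
        | single g r =>
          rw [coeff_mul_simpleQuantity]
          simp only [MonoidAlgebra.mapDomainRingHom_apply, MonoidAlgebra.mapDomain_single,
            MonoidAlgebra.coeff_single, Finsupp.single_apply, QuotientGroup.mk'_apply,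
            QuotientGroup.eq]
          by_cases hgz : g⁻¹ * z ∈ L
          · rw [if_pos hgz, Finset.sum_eq_single (g⁻¹ * z)]
            · simp
            · intro l _ hl
              rw [if_neg]
              rintro rfl
              simp at hl
            · intro hn
              simp [hgz] at hn
          · rw [if_neg hgz, Finset.sum_eq_zero]
            intro l hl
            rw [if_neg]
            rintro rfl
            exact hgz (by simpa using hl)
      have hconst : ∀ f ∈ A.toSubring, ∀ Z ∈ A.basicSets, ∀ x ∈ Z, ∀ y ∈ Z,
          (MonoidAlgebra.mapDomainRingHom ℤ (QuotientGroup.mk' L) f).coeff (x : G ⧸ L) =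
          (MonoidAlgebra.mapDomainRingHom ℤ (QuotientGroup.mk' L) f).coeff (y : G ⧸ L) := by
        intro f hf Z hZ x hx y hy
        rw [hcoeff, hcoeff]
        exact (A.mem_iff _).1 (A.toSubring.mul_mem hf hL) Z hZ x hx y hy
      have hmap : ∀ X ∈ A.basicSets, ∃ c : ℤ, c ≠ 0 ∧
          MonoidAlgebra.mapDomainRingHom ℤ (QuotientGroup.mk' L) (simpleQuantity X) =
            c • simpleQuantity (((↑) : G → G ⧸ L) '' X) := by
        intro X hX
        obtain ⟨x, hx⟩ := Setoid.nonempty_of_mem_partition A.isPartition hX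
        refine ⟨(simpleQuantity X * simpleQuantity (L : Set G)).coeff x, ?_, ?_⟩
        · intro h0
          exact (coeff_mul_subgroup_eq_zero_iff X L x).1 h0 ⟨x, hx, rfl⟩
        · ext w
          obtain ⟨z, rfl⟩ := QuotientGroup.mk_surjective w
          by_cases hz : (z : G ⧸ L) ∈ ((↑) : G → G ⧸ L) '' X
          · rw [MonoidAlgebra.coeff_smul, Finsupp.smul_apply, coeff_simpleQuantity, if_pos hz]
            obtain ⟨x', hx', hx'z⟩ := hz
            rw [← hx'z, hconst _ (A.simpleQuantity_mem hX) X hX x' hx' x hx, hcoeff]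
            simp
          · rw [MonoidAlgebra.coeff_smul, Finsupp.smul_apply, coeff_simpleQuantity, if_neg hz,
              hcoeff, (coeff_mul_subgroup_eq_zero_iff X L z).2 hz, smul_zero]
      rintro _ ⟨X, hX, rfl⟩ _ ⟨Y, hY, rfl⟩
      rw [mem_span_iff_of_isPartition (A.isPartition_quotientBasicSets L hL)]
      rintro _ ⟨Z, hZ, rfl⟩ _ ⟨x, hx, rfl⟩ _ ⟨y, hy, rfl⟩
      obtain ⟨c, hc, hcX⟩ := hmap X hX
      obtain ⟨d, hd, hdY⟩ := hmap Y hY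
      have := hconst _ (A.toSubring.mul_mem (A.simpleQuantity_mem hX) (A.simpleQuantity_mem hY))
        Z hZ x hx y hy
      rw [map_mul, hcX, hdY, smul_mul_smul_comm] at this
      simp only [MonoidAlgebra.coeff_smul, Finsupp.smul_apply, smul_eq_mul] at this
      exact mul_left_cancel₀ (mul_ne_zero hc hd) this)

/-- The radical of `X`: the group of all `g` with `gX = Xg = X`. -/
def rad (X : Set G) : Subgroup G :=
  MulAction.stabilizer G X ⊓ (MulAction.stabilizer Gᵐᵒᵖ X).unop

/-- `A` is the (generalized) `U/L`-wreath product: `L ≤ U` are `A`-subgroups, `L` is normal in `G`,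
and `L ≤ rad X` for every basic set `X` outside `U`. -/
structure IsWreathProduct (U L : Subgroup G) : Prop where
  isASubgroup_top : A.IsASubgroup U
  isASubgroup_bot : A.IsASubgroup L
  le : L ≤ U
  normal : L.Normal
  le_rad : ∀ X ∈ A.basicSetsIn (U : Set G)ᶜ, L ≤ rad X

/-- `A` is the nontrivial `U/L`-wreath product: in addition `L ≠ 1` and `U ≠ G`. -/
structure IsNontrivialWreathProduct (U L : Subgroup G) : Prop
    extends A.IsWreathProduct U L where
  ne_bot : L ≠ ⊥
  ne_top : U ≠ ⊤

/-- `A = A_V ⋆ A_W`, the star product. -/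
structure IsStarProduct (V W : Subgroup G) : Prop where
  isASubgroup_left : A.IsASubgroup V
  isASubgroup_right : A.IsASubgroup W
  /-- `V ∩ W` is normal in `W`. -/
  normal : (V.subgroupOf W).Normal
  /-- Every basic set inside `W \ V` is a union of cosets of `V ∩ W`. -/
  le_rad : ∀ X ∈ A.basicSetsIn ((W : Set G) \ V), V ⊓ W ≤ rad X
  /-- Every basic set outside `V ∪ W` is a product of a basic set of `A_V` and one of `A_W`. -/
  eq_mul : ∀ X ∈ A.basicSetsIn ((V : Set G) ∪ W)ᶜ,
    ∃ R ∈ A.basicSetsIn (V : Set G), ∃ S ∈ A.basicSetsIn (W : Set G), X = R * S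

/-- `A = A_U ⊗ A_V`: `U` and `V` are `A`-subgroups, `G = U × V`, and the basic sets of `A` are
exactly the products of basic sets of `A_U` and `A_V`. -/
structure IsTensorProduct (U V : Subgroup G) : Prop where
  isASubgroup_left : A.IsASubgroup U
  isASubgroup_right : A.IsASubgroup V
  isCompl : IsCompl U V
  commute : ∀ u ∈ U, ∀ v ∈ V, Commute u v
  basicSets_eq : A.basicSets =
    {X | ∃ R ∈ A.basicSetsIn (U : Set G), ∃ S ∈ A.basicSetsIn (V : Set G), X = R * S}

/-- `A_U` is `⊗`-complemented in `A`: `A = A_U ⊗ A_V` for some `A`-subgroup `V`. -/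
def IsTensorComplemented (U : Subgroup G) : Prop := ∃ V : Subgroup G, A.IsTensorProduct U V

end Constructions

end SchurRing

end

/-! Let `e` be the involution of `P`. Modulo 2 the square of the sum over a set `T` is the sum of
the squares `t ^ 2`, so for an `A`-set `T` the elements with an odd number of square roots in `T`
form an `A`-set (`IsASet.odd_ncard_square_roots`). As `|G|` is twice an odd number, squaring maps
`G` into `H`, has fibres `{x, x * e}`, and permutes `H`. The odd-root set of an `A`-set `X` thus
records the `x ∈ X` whose partner `x * e` is missing, and as an `A`-set inside `H` it lies in `H₁`.

Two facts follow: if neither `x` nor `x * e` is in `H₁`, then `X` contains both or neither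
(`IsASet.mul_mem_of_notMem`); and if `X` misses `H₁`, the `h ∈ H₁` with `h * e ∈ X` form an `A`-set
(`IsASet.isASet_mul_mem`).

These determine the basic sets outside `H₁`. The one containing `e` is `P₁ \ H₁`; those in `H₁P₁ \
H₁` are the products `R * (P₁ \ H₁)` with `R` a basic set in `H₁`; those outside `H₁P₁` are stable
under `e`, hence unions of `P₁`-cosets. The alternatives are read off according to whether `H₁P₁ =
G` and whether `H₁ ∩ P₁ = 1`. -/

noncomputable section

namespace SchurRing

/-! ### Calculus of `A`-sets and `A`-subgroups in an abelian group. -/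

section ASets

variable {G : Type*} [CommGroup G] [Finite G] {A : SchurRing G}

theorem exists_basicSet (A : SchurRing G) (g : G) : ∃ X ∈ A.basicSets, g ∈ X := by
  obtain ⟨X, ⟨hX, hg⟩, -⟩ := A.isPartition.2 g
  exact ⟨X, hX, hg⟩

theorem nonempty_of_mem_basicSets {X : Set G} (hX : X ∈ A.basicSets) : X.Nonempty :=
  Setoid.nonempty_of_mem_partition A.isPartition hX

theorem eq_of_mem_basicSets {X Y : Set G} (hX : X ∈ A.basicSets) (hY : Y ∈ A.basicSets) {g : G}
    (hgX : g ∈ X) (hgY : g ∈ Y) : X = Y :=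
  (A.isPartition.2 g).unique ⟨hX, hgX⟩ ⟨hY, hgY⟩

theorem isASet_of_forall {T : Set G}
    (h : ∀ X ∈ A.basicSets, ∀ x ∈ X, ∀ y ∈ X, x ∈ T → y ∈ T) : A.IsASet T := by
  classical
  refine (A.mem_iff _).2 fun X hX x hx y hy => ?_
  rw [coeff_simpleQuantity, coeff_simpleQuantity]
  simp only [show x ∈ T ↔ y ∈ T from ⟨h X hX x hx y hy, h X hX y hy x hx⟩]

theorem isASet_of_mem_basicSets {X : Set G} (hX : X ∈ A.basicSets) : A.IsASet X :=
  A.simpleQuantity_mem hX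

theorem IsASet.union {S T : Set G} (hS : A.IsASet S) (hT : A.IsASet T) : A.IsASet (S ∪ T) :=
  isASet_of_forall fun _ hX _ hx _ hy h =>
    h.imp (fun h => hS.subset hX hx h hy) fun h => hT.subset hX hx h hy

theorem IsASet.inter {S T : Set G} (hS : A.IsASet S) (hT : A.IsASet T) : A.IsASet (S ∩ T) :=
  isASet_of_forall fun _ hX _ hx _ hy h => ⟨hS.subset hX hx h.1 hy, hT.subset hX hx h.2 hy⟩

theorem IsASet.inv {T : Set G} (hT : A.IsASet T) : A.IsASet T⁻¹ :=
  isASet_of_forall fun X hX _ hx _ hy h =>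
    hT.subset (A.inv_mem X hX) (Set.inv_mem_inv.2 hx) h (Set.inv_mem_inv.2 hy)

/-- The number of factorizations `g = s * t` with `s ∈ S` and `t ∈ T` is constant on the basic
sets when `S` and `T` are `A`-sets. -/
theorem ncard_factorizations_eq {S T : Set G} (hS : A.IsASet S) (hT : A.IsASet T) {X : Set G}
    (hX : X ∈ A.basicSets) {x y : G} (hx : x ∈ X) (hy : y ∈ X) :
    {t ∈ T | x * t⁻¹ ∈ S}.ncard = {t ∈ T | y * t⁻¹ ∈ S}.ncard := by
  classical
  have key : ∀ z : G, (simpleQuantity S * simpleQuantity T).coeff z =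
      ({t ∈ T | z * t⁻¹ ∈ S}.ncard : ℤ) := by
    intro z
    rw [coeff_mul_simpleQuantity]
    simp only [coeff_simpleQuantity]
    rw [Finset.sum_boole, ← Set.ncard_coe_finset]
    congr 2
    ext t
    simp
  have := (A.mem_iff _).1 (A.toSubring.mul_mem hS hT) X hX x hx y hy
  rw [key, key] at this
  exact_mod_cast this

/-- Used with `p` as `n ≠ 0` for product sets and as `Odd` for the squaring argument modulo 2. -/
theorem isASet_ncard_factorizations {S T : Set G} (hS : A.IsASet S) (hT : A.IsASet T)
    (p : ℕ → Prop) : A.IsASet {g | p {t ∈ T | g * t⁻¹ ∈ S}.ncard} :=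
  isASet_of_forall fun X hX x hx y hy h => by
    change p _ at h ⊢
    rwa [← ncard_factorizations_eq hS hT hX hx hy]

theorem IsASet.mul {S T : Set G} (hS : A.IsASet S) (hT : A.IsASet T) : A.IsASet (S * T) := by
  convert isASet_ncard_factorizations hS hT (fun n => n ≠ 0) using 1
  ext g
  change _ ↔ _ ≠ 0
  rw [Ne, Set.ncard_eq_zero (Set.toFinite _), ← Ne, ← Set.nonempty_iff_ne_empty]
  constructor
  · rintro ⟨s, hs, t, ht, rfl⟩
    exact ⟨t, ht, by simpa using hs⟩
  · rintro ⟨t, ht, hs⟩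
    exact ⟨_, hs, t, ht, by simp⟩

/-- If `R * x ⊆ S` for `A`-sets `R`, `S` and one element `x` of a basic set, then the same holds
for every element of that basic set. -/
theorem mul_mem_of_forall_mul_mem {R S X : Set G} (hR : A.IsASet R) (hS : A.IsASet S)
    (hX : X ∈ A.basicSets) {x y : G} (hx : x ∈ X) (hy : y ∈ X) (h : ∀ r ∈ R, r * x ∈ S) :
    ∀ r ∈ R, r * y ∈ S := by
  -- The number of `r ∈ R` with `r * x ∈ S` is a factorization count, constant on `X`; being maximal
  -- at `x`, it is maximal at `y`.
  have hc := ncard_factorizations_eq hS hR.inv hX hx hy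
  have hx' : {t ∈ R⁻¹ | x * t⁻¹ ∈ S} = R⁻¹ := by
    refine Set.Subset.antisymm (fun t ht => ht.1) fun t ht => ⟨ht, ?_⟩
    rw [mul_comm]
    exact h _ ht
  rw [hx'] at hc
  have hy' := Set.eq_of_subset_of_ncard_le (fun t ht => ht.1 : {t ∈ R⁻¹ | y * t⁻¹ ∈ S} ⊆ R⁻¹) hc.le
  intro r hr
  have : r⁻¹ ∈ {t ∈ R⁻¹ | y * t⁻¹ ∈ S} := by
    rw [hy']
    simpa using hr
  simpa [mul_comm] using this.2

theorem mem_rad {X : Set G} {g : G} : g ∈ rad X ↔ ∀ x ∈ X, g * x ∈ X := by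
  rw [rad, Subgroup.mem_inf, Subgroup.mem_unop, MulAction.mem_stabilizer_iff,
    MulAction.mem_stabilizer_iff]
  constructor
  · rintro ⟨h, -⟩ x hx
    rw [← h]
    exact Set.smul_mem_smul_set hx
  · intro h
    have : g • X = X := by
      refine Set.eq_of_subset_of_ncard_le ?_ (Set.ncard_smul_set g X).ge
      rintro _ ⟨x, hx, rfl⟩
      exact h x hx
    refine ⟨this, ?_⟩
    rwa [op_smul_eq_smul]

theorem isASubgroup_rad {X : Set G} (hX : A.IsASet X) : A.IsASubgroup (rad X) := by
  refine isASet_of_forall fun Y hY x hx y hy h => ?_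
  rw [SetLike.mem_coe, mem_rad] at h ⊢
  have := mul_mem_of_forall_mul_mem hX hX hY hx hy fun r hr => mul_comm x r ▸ h r hr
  exact fun r hr => mul_comm r y ▸ this r hr

/-- Each element of the closure lies in an `A`-set inside the closure, built from `T` by products
and inverses. -/
theorem isASubgroup_closure {T : Set G} (hT : A.IsASet T) :
    A.IsASubgroup (Subgroup.closure T) := by
  have key : ∀ x ∈ Subgroup.closure T,
      ∃ S, A.IsASet S ∧ x ∈ S ∧ S ⊆ (Subgroup.closure T : Set G) := by
    intro x hx
    induction hx using Subgroup.closure_induction with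
    | mem x hx => exact ⟨T, hT, hx, Subgroup.subset_closure⟩
    | one => exact ⟨{1}, isASet_of_mem_basicSets A.one_mem, rfl, by simp⟩
    | mul x y _ _ hx hy =>
      obtain ⟨S, hS, hxS, hSc⟩ := hx
      obtain ⟨S', hS', hyS, hSc'⟩ := hy
      refine ⟨S * S', hS.mul hS', Set.mul_mem_mul hxS hyS, ?_⟩
      rintro _ ⟨s, hs, t, ht, rfl⟩
      exact mul_mem (hSc hs) (hSc' ht)
    | inv x _ hx =>
      obtain ⟨S, hS, hxS, hSc⟩ := hx
      exact ⟨S⁻¹, hS.inv, by simpa using hxS, fun y hy => inv_mem_iff.1 (hSc hy)⟩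
  refine isASet_of_forall fun X hX x hx y hy h => ?_
  obtain ⟨S, hS, hxS, hSc⟩ := key x h
  exact hSc (hS.subset hX hx hxS hy)

theorem IsASubgroup.sup {U V : Subgroup G} (hU : A.IsASubgroup U) (hV : A.IsASubgroup V) :
    A.IsASubgroup (U ⊔ V) := by
  have := isASubgroup_closure (IsASet.union hU hV)
  rwa [Subgroup.closure_union, Subgroup.closure_eq, Subgroup.closure_eq] at this

theorem IsASubgroup.inf {U V : Subgroup G} (hU : A.IsASubgroup U) (hV : A.IsASubgroup V) :
    A.IsASubgroup (U ⊓ V) := by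
  have := IsASet.inter hU hV
  rwa [← Subgroup.coe_inf] at this

theorem IsASubgroup.subgroupOf {U V : Subgroup G} (hU : A.IsASubgroup U) (hV : A.IsASubgroup V) :
    (A.restrict U hU).IsASubgroup (V.subgroupOf U) := by
  refine isASet_of_forall fun X hX x hx y hy h => ?_
  exact hV.subset hX ⟨x, hx, rfl⟩ h ⟨y, hy, rfl⟩

/-- The involution `t ↦ g * t⁻¹` pairs off the factorizations of `g`; its fixed points are the
square roots of `g`. -/
theorem odd_ncard_factorizations_iff (T : Set G) (g : G) :
    Odd {t ∈ T | g * t⁻¹ ∈ T}.ncard ↔ Odd {t ∈ T | t ^ 2 = g}.ncard := by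
  classical
  have := Fintype.ofFinite G
  have h1 : {t ∈ T | g * t⁻¹ ∈ T}.ncard =
      (Finset.univ.filter fun t => t ∈ T ∧ g * t⁻¹ ∈ T).card := by
    rw [← Set.ncard_coe_finset]; congr 1; ext; simp
  have h2 : {t ∈ T | t ^ 2 = g}.ncard =
      ((Finset.univ.filter fun t => t ∈ T ∧ g * t⁻¹ ∈ T).filter fun t => t ^ 2 = g).card := by
    rw [← Set.ncard_coe_finset]
    congr 1
    ext t
    simp only [Set.mem_ofPred_eq, Finset.coe_filter, Finset.mem_filter, Finset.mem_univ, true_and]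
    constructor
    · rintro ⟨ht, rfl⟩
      exact ⟨⟨ht, by simpa [pow_two] using ht⟩, rfl⟩
    · rintro ⟨⟨ht, -⟩, h⟩
      exact ⟨ht, h⟩
  have h3 : Even ((Finset.univ.filter fun t => t ∈ T ∧ g * t⁻¹ ∈ T).filter
      fun t => ¬ t ^ 2 = g).card := by
    -- Parity becomes a sum of ones in `ZMod 2`, where paired terms cancel.
    rw [← ZMod.natCast_eq_zero_iff_even, Finset.card_eq_sum_ones, Nat.cast_sum]
    refine Finset.sum_involution (fun t _ => g * t⁻¹) (fun _ _ => by decide) ?_ ?_ ?_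
    · intro t ht _ h
      refine (Finset.mem_filter.1 ht).2 ?_
      rw [pow_two, ← mul_inv_eq_iff_eq_mul.1 h]
    · intro t ht
      simp only [Finset.mem_filter, Finset.mem_univ, true_and] at ht ⊢
      refine ⟨⟨ht.1.2, by simpa using ht.1.1⟩, fun h => ht.2 ?_⟩
      rw [mul_pow, inv_pow, mul_inv_eq_iff_eq_mul, pow_two g] at h
      exact (mul_left_cancel h).symm
    · intro t _
      simp
  rw [h1, h2, ← Finset.card_filter_add_card_filter_not (fun t => t ^ 2 = g), Nat.odd_add]
  exact iff_true_right h3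

/-- The elements with an odd number of square roots in an `A`-set form an `A`-set. -/
theorem IsASet.odd_ncard_square_roots {T : Set G} (hT : A.IsASet T) :
    A.IsASet {g | Odd {t ∈ T | t ^ 2 = g}.ncard} := by
  have := isASet_ncard_factorizations hT hT Odd
  simpa only [odd_ncard_factorizations_iff] using this

theorem eq_of_basicSets_eq {A B : SchurRing G} (h : A.basicSets = B.basicSets) : A = B := by
  have : A.toSubring = B.toSubring := by
    rw [← SetLike.coe_set_eq, A.span_eq, B.span_eq, h]
  cases A
  cases B
  cases h
  cases this
  rfl

theorem eq_trivial_of_compl_one_mem {A : SchurRing G} (h : {1}ᶜ ∈ A.basicSets) :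
    A = SchurRing.trivial G := by
  refine eq_of_basicSets_eq (Set.Subset.antisymm (fun X hX => ?_) ?_)
  · obtain ⟨x, hx⟩ := nonempty_of_mem_basicSets hX
    refine ⟨⟨x, hx⟩, ?_⟩
    by_cases h1 : x = 1
    · exact Or.inl (eq_of_mem_basicSets hX A.one_mem hx h1)
    · exact Or.inr (eq_of_mem_basicSets hX h hx h1)
  · rintro X ⟨-, rfl | rfl⟩
    exacts [A.one_mem, h]

end ASets

/-! ### Squaring in the presence of an odd-order subgroup. -/

variable {G : Type*} [CommGroup G]

theorem eq_of_sq_eq_of_odd_card {H : Subgroup G} (hH : Odd (Nat.card H)) {x y : G} (hx : x ∈ H)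
    (hy : y ∈ H) (h : x ^ 2 = y ^ 2) : x = y := by
  have hc : (Nat.card H).Coprime 2 := Nat.coprime_two_right.2 hH
  have : (⟨x, hx⟩ : H) = ⟨y, hy⟩ :=
    (powCoprime hc).injective (Subtype.ext (by simpa [powCoprime] using h))
  exact congrArg Subtype.val this

theorem pow_card_eq_one_of_mem {H : Subgroup G} {x : G} (hx : x ∈ H) : x ^ Nat.card H = 1 := by
  have : (⟨x, hx⟩ : H) ^ Nat.card H = 1 := pow_card_eq_one'
  exact congrArg Subtype.val this

theorem mem_of_sq_mem_of_odd_card {H K : Subgroup G} (hH : Odd (Nat.card H)) {x : G} (hx : x ∈ H)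
    (h : x ^ 2 ∈ K) : x ∈ K := by
  obtain ⟨m, hm⟩ := hH
  have h1 : x ^ Nat.card H = 1 := pow_card_eq_one_of_mem hx
  have h2 : x = (x ^ 2) ^ (m + 1) := by
    rw [← pow_mul, show 2 * (m + 1) = Nat.card H + 1 by omega, pow_succ, h1, one_mul]
  rw [h2]
  exact pow_mem h _

/-- A subgroup of odd order and index `2`, together with an involution outside it. -/
structure IsOddComplement (H : Subgroup G) (e : G) : Prop where
  odd_card : Odd (Nat.card H)
  index_eq : H.index = 2
  mul_self : e * e = 1
  notMem : e ∉ H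

namespace IsOddComplement

variable {H : Subgroup G} {e : G}

theorem mul_mem (h : IsOddComplement H e) {x : G} (hx : x ∉ H) : x * e ∈ H :=
  (Subgroup.mul_mem_iff_of_index_two h.index_eq).2 (iff_of_false hx h.notMem)

theorem sq_mem (h : IsOddComplement H e) (x : G) : x ^ 2 ∈ H :=
  Subgroup.sq_mem_of_index_two h.index_eq x

/-- The kernel of squaring is `{1, e}`: `H` has no involution, and the other coset is `He`. -/
theorem eq_or_eq_of_sq_eq (h : IsOddComplement H e) {x y : G} (hxy : x ^ 2 = y ^ 2) :
    x = y ∨ x = y * e := by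
  have hsq : (x * y⁻¹) ^ 2 = 1 ^ 2 := by rw [mul_pow, hxy, inv_pow, mul_inv_cancel, one_pow]
  by_cases hm : x * y⁻¹ ∈ H
  · exact Or.inl (mul_inv_eq_one.1 (eq_of_sq_eq_of_odd_card h.odd_card hm H.one_mem hsq))
  · right
    have := eq_of_sq_eq_of_odd_card h.odd_card (h.mul_mem hm) H.one_mem
      (by rw [mul_pow, hsq, pow_two e, h.mul_self, mul_one])
    rw [mul_eq_one_iff_eq_inv, mul_inv_eq_iff_eq_mul, inv_eq_of_mul_eq_one_right h.mul_self] at this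
    rw [this, mul_comm]

theorem mul_mul_cancel (h : IsOddComplement H e) (x : G) : x * e * e = x := by
  rw [mul_assoc, h.mul_self, mul_one]

/-- If exactly one of `x`, `x * e` lies in `T`, then `x ^ 2` has a single square root in `T`. -/
theorem ncard_square_roots (h : IsOddComplement H e) {T : Set G} {x : G} (hx : x ∈ T)
    (hxe : x * e ∉ T) : {t ∈ T | t ^ 2 = x ^ 2}.ncard = 1 := by
  rw [Set.ncard_eq_one]
  refine ⟨x, Set.Subset.antisymm ?_ ?_⟩
  · rintro t ⟨ht, htx⟩
    rcases h.eq_or_eq_of_sq_eq htx with rfl | rfl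
    exacts [rfl, absurd ht hxe]
  · rintro _ rfl
    exact ⟨hx, rfl⟩

end IsOddComplement

variable [Finite G] {A : SchurRing G}

/-- Squaring is injective on `H`, so root counts in `T` are 0 or 1, and odd means nonzero. -/
theorem IsASet.image_sq {H : Subgroup G} (hH : Odd (Nat.card H)) {T : Set G} (hT : A.IsASet T)
    (hTH : T ⊆ H) : A.IsASet ((fun x => x ^ 2) '' T) := by
  convert hT.odd_ncard_square_roots using 1
  ext g
  constructor
  · rintro ⟨t, ht, rfl⟩
    have : {s ∈ T | s ^ 2 = t ^ 2} = {t} := by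
      ext s
      constructor
      · rintro ⟨hs, h⟩
        exact eq_of_sq_eq_of_odd_card hH (hTH hs) (hTH ht) h
      · rintro rfl
        exact ⟨ht, rfl⟩
    change Odd (Set.ncard {s ∈ T | s ^ 2 = t ^ 2})
    rw [this, Set.ncard_singleton]
    exact odd_one
  · intro h
    obtain ⟨t, ht, h⟩ := Set.nonempty_of_ncard_ne_zero (Odd.pos h).ne'
    exact ⟨t, ht, h⟩

/-- Squaring has finite order as a permutation of `H`: by Euler, `φ(|H|)` squarings return `T`. The
hypothesis supplies the first, leaving `φ(|H|) - 1`. -/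
theorem isASet_of_image_sq {H : Subgroup G} (hH : Odd (Nat.card H)) {T : Set G} (hTH : T ⊆ H)
    (hT : A.IsASet ((fun x => x ^ 2) '' T)) : A.IsASet T := by
  have key : ∀ k : ℕ, A.IsASet ((fun x => x ^ 2 ^ (k + 1)) '' T) := by
    intro k
    induction k with
    | zero => simpa using hT
    | succ k ih =>
      have := ih.image_sq hH (by
        rintro _ ⟨t, ht, rfl⟩
        exact pow_mem (hTH ht) _)
      simpa only [Set.image_image, ← pow_mul, ← pow_succ] using this
  have hφ : 0 < (Nat.card H).totient := Nat.totient_pos.2 Nat.card_pos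
  have := key ((Nat.card H).totient - 1)
  rw [Nat.sub_add_cancel hφ] at this
  convert this using 1
  rw [Set.image_congr (g := id), Set.image_id]
  intro t ht
  have hmod : 2 ^ (Nat.card H).totient ≡ 1 [MOD Nat.card H] :=
    Nat.ModEq.pow_totient (Nat.coprime_two_left.2 hH)
  have hord : orderOf t ∣ Nat.card H := orderOf_dvd_of_pow_eq_one (pow_card_eq_one_of_mem (hTH ht))
  simpa using pow_eq_pow_iff_modEq.2 (hmod.of_dvd hord)

/-! ### Basic sets relative to `H₁` and `P₁`. -/

section Maximal

variable {H H₁ : Subgroup G} {e : G}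

/-- Joining `H₁` with the closure of `T` gives an `A`-subgroup inside `H`, so a maximal `H₁` is in
fact the largest. -/
theorem IsASet.subset_of_maximal
    (hH₁ : Maximal (fun K : Subgroup G => A.IsASubgroup K ∧ K ≤ H) H₁) {T : Set G}
    (hT : A.IsASet T) (hTH : T ⊆ H) : T ⊆ H₁ := by
  have := hH₁.le_of_ge
    ⟨hH₁.prop.1.sup (isASubgroup_closure hT), sup_le hH₁.prop.2 ((Subgroup.closure_le H).2 hTH)⟩
    le_sup_left
  exact fun t ht => this (Subgroup.mem_sup_right (Subgroup.subset_closure ht))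

/-- If `x * e` were missing, `x ^ 2` would have a single root in `X`, hence lie in `H₁`; then so
would its root in `H`, which is `x` or `x * e`. -/
theorem IsASet.mul_mem_of_notMem (he : IsOddComplement H e)
    (hH₁ : Maximal (fun K : Subgroup G => A.IsASubgroup K ∧ K ≤ H) H₁) {X : Set G}
    (hX : A.IsASet X) {x : G} (hx : x ∈ X) (h1 : x ∉ H₁) (h2 : x * e ∉ H₁) : x * e ∈ X := by
  by_contra hxe
  have hsub : {g | Odd {t ∈ X | t ^ 2 = g}.ncard} ⊆ (H₁ : Set G) := by
    refine hX.odd_ncard_square_roots.subset_of_maximal hH₁ fun g hg => ?_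
    obtain ⟨t, -, rfl⟩ := Set.nonempty_of_ncard_ne_zero (Odd.pos hg).ne'
    exact he.sq_mem t
  have hx2 : x ^ 2 ∈ H₁ := hsub (by
    change Odd (Set.ncard _)
    rw [he.ncard_square_roots hx hxe]
    exact odd_one)
  by_cases hxH : x ∈ H
  · exact h1 (mem_of_sq_mem_of_odd_card he.odd_card hxH hx2)
  · refine h2 (mem_of_sq_mem_of_odd_card he.odd_card (he.mul_mem hxH) ?_)
    rwa [mul_pow, pow_two e, he.mul_self, mul_one]

/-- For `h ∈ H₁` the only roots of `h ^ 2` are `h` and `h * e`, and `h ∉ X`. So the odd-root set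
meets `H₁` in the squares of the set in question, and squaring on `H` can be undone. -/
theorem IsASet.isASet_mul_mem (he : IsOddComplement H e)
    (hH₁ : Maximal (fun K : Subgroup G => A.IsASubgroup K ∧ K ≤ H) H₁) {X : Set G}
    (hX : A.IsASet X) (hd : ∀ x ∈ X, x ∉ H₁) : A.IsASet {h | h ∈ H₁ ∧ h * e ∈ X} := by
  refine isASet_of_image_sq he.odd_card (fun h hh => hH₁.prop.2 hh.1) ?_
  convert IsASet.inter hX.odd_ncard_square_roots hH₁.prop.1 using 1
  ext g
  constructor
  · rintro ⟨h, ⟨hh, hX'⟩, rfl⟩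
    refine ⟨?_, pow_mem hh 2⟩
    have := he.ncard_square_roots hX' (by rw [he.mul_mul_cancel]; exact fun hc => hd _ hc hh)
    rw [mul_pow, pow_two e, he.mul_self, mul_one] at this
    change Odd (Set.ncard _)
    rw [this]
    exact odd_one
  · rintro ⟨hg, hgH⟩
    obtain ⟨t, ht, rfl⟩ := Set.nonempty_of_ncard_ne_zero (Odd.pos hg).ne'
    have htH : t ∉ H := fun hc => hd t ht (mem_of_sq_mem_of_odd_card he.odd_card hc hgH)
    have hsq : (t * e) ^ 2 = t ^ 2 := by rw [mul_pow, pow_two e, he.mul_self, mul_one]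
    refine ⟨t * e, ⟨mem_of_sq_mem_of_odd_card he.odd_card (he.mul_mem htH) ?_, ?_⟩, hsq⟩
    · rw [hsq]
      exact hgH
    · rwa [he.mul_mul_cancel]

variable {P₁ : Subgroup G}

theorem le_rad_of_mul_mem (hP₁ : IsLeast {K : Subgroup G | A.IsASubgroup K ∧ e ∈ K} P₁) {X : Set G}
    (hX : A.IsASet X) (h : ∀ x ∈ X, x * e ∈ X) : P₁ ≤ rad X :=
  hP₁.2 ⟨isASubgroup_rad hX, mem_rad.2 fun x hx => mul_comm x e ▸ h x hx⟩

/-- The basic set of the involution is `P₁ \ H₁`. -/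
theorem diff_mem_basicSets (he : IsOddComplement H e)
    (hH₁ : Maximal (fun K : Subgroup G => A.IsASubgroup K ∧ K ≤ H) H₁)
    (hP₁ : IsLeast {K : Subgroup G | A.IsASubgroup K ∧ e ∈ K} P₁) :
    (P₁ : Set G) \ H₁ ∈ A.basicSets := by
  obtain ⟨X, hX, heX⟩ := A.exists_basicSet e
  have hXA := isASet_of_mem_basicSets hX
  have hd : ∀ x ∈ X, x ∉ H₁ := fun x hx hxH =>
    he.notMem (hH₁.prop.2 (hH₁.prop.1.subset hX hx hxH heX))
  -- Adding the missing partners, all in `H₁`, makes `X` stable under `e`. The enlarged set contains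
  -- 1, as `e ∈ X`, hence all of `P₁`.
  have hrad : P₁ ≤ rad (X ∪ {h | h ∈ H₁ ∧ h * e ∈ X}) := by
    refine le_rad_of_mul_mem hP₁ (hXA.union (hXA.isASet_mul_mem he hH₁ hd)) ?_
    rintro x (hx | ⟨-, hx⟩)
    · by_cases hxe : x * e ∈ H₁
      · exact Or.inr ⟨hxe, by rwa [he.mul_mul_cancel]⟩
      · exact Or.inl (hXA.mul_mem_of_notMem he hH₁ hx (hd x hx) hxe)
    · exact Or.inl hx
  convert hX
  refine Set.Subset.antisymm ?_ fun x hx => ⟨hP₁.1.1.subset hX heX hP₁.1.2 hx, hd x hx⟩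
  rintro x ⟨hxP, hxH⟩
  have := mem_rad.1 (hrad hxP) 1 (Or.inr ⟨H₁.one_mem, by rwa [one_mul]⟩)
  rw [mul_one] at this
  exact this.resolve_right fun h => hxH h.1

theorem mem_diff (he : IsOddComplement H e)
    (hH₁ : Maximal (fun K : Subgroup G => A.IsASubgroup K ∧ K ≤ H) H₁)
    (hP₁ : IsLeast {K : Subgroup G | A.IsASubgroup K ∧ e ∈ K} P₁) : e ∈ (P₁ : Set G) \ H₁ :=
  ⟨hP₁.1.2, fun h => he.notMem (hH₁.prop.2 h)⟩

/-- The `A`-set of those `h ∈ H₁` with `h * e ∈ X` meets `R`, so it contains `R`. The inclusion `R *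
e ⊆ X` then spreads from `e` to its whole basic set. -/
theorem eq_mul_diff (he : IsOddComplement H e)
    (hH₁ : Maximal (fun K : Subgroup G => A.IsASubgroup K ∧ K ≤ H) H₁)
    (hP₁ : IsLeast {K : Subgroup G | A.IsASubgroup K ∧ e ∈ K} P₁) {X R : Set G}
    (hX : X ∈ A.basicSets) (hR : R ∈ A.basicSets) {h : G} (hh : h ∈ H₁) (hhR : h ∈ R)
    (hhX : h * e ∈ X) : X = R * ((P₁ : Set G) \ H₁) := by
  have hX₀ := diff_mem_basicSets he hH₁ hP₁
  have heX₀ := mem_diff he hH₁ hP₁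
  have hXA := isASet_of_mem_basicSets hX
  have hRA := isASet_of_mem_basicSets hR
  have hd : ∀ x ∈ X, x ∉ H₁ := fun x hx hxH =>
    he.notMem (hH₁.prop.2 ((mul_mem_cancel_left hh).1 (hH₁.prop.1.subset hX hx hxH hhX)))
  have hRX : ∀ r ∈ R, r * e ∈ X := fun r hr =>
    ((hXA.isASet_mul_mem he hH₁ hd).subset hR hhR ⟨hh, hhX⟩ hr).2
  refine Set.Subset.antisymm ?_ ?_
  · exact (hRA.mul (isASet_of_mem_basicSets hX₀)).subset hX hhX (Set.mul_mem_mul hhR heX₀)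
  · rintro _ ⟨r, hr, x, hx, rfl⟩
    exact mul_mem_of_forall_mul_mem hRA hXA hX₀ heX₀ hx hRX r hr

theorem mul_diff_mem_basicSets (he : IsOddComplement H e)
    (hH₁ : Maximal (fun K : Subgroup G => A.IsASubgroup K ∧ K ≤ H) H₁)
    (hP₁ : IsLeast {K : Subgroup G | A.IsASubgroup K ∧ e ∈ K} P₁) {R : Set G}
    (hR : R ∈ A.basicSetsIn (H₁ : Set G)) : R * ((P₁ : Set G) \ H₁) ∈ A.basicSets := by
  obtain ⟨h, hh⟩ := nonempty_of_mem_basicSets hR.1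
  obtain ⟨X, hX, hhX⟩ := A.exists_basicSet (h * e)
  rwa [← eq_mul_diff he hH₁ hP₁ hX hR.1 (hR.2 hh) hh hhX]

/-- If `X` missed `H₁ * e`, it would be stable under `e` and so a union of `P₁`-cosets; but every
`P₁`-coset in `H₁P₁` meets `H₁`. -/
theorem exists_eq_mul_diff (he : IsOddComplement H e)
    (hH₁ : Maximal (fun K : Subgroup G => A.IsASubgroup K ∧ K ≤ H) H₁)
    (hP₁ : IsLeast {K : Subgroup G | A.IsASubgroup K ∧ e ∈ K} P₁) {X : Set G}
    (hX : X ∈ A.basicSets) {x : G} (hx : x ∈ X) (hxU : x ∈ H₁ ⊔ P₁) (hxH : x ∉ H₁) :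
    ∃ R ∈ A.basicSetsIn (H₁ : Set G), X = R * ((P₁ : Set G) \ H₁) := by
  have hXA := isASet_of_mem_basicSets hX
  have hd : ∀ y ∈ X, y ∉ H₁ := fun y hy hyH => hxH (hH₁.prop.1.subset hX hy hyH hx)
  obtain ⟨h, hh, hhX⟩ : ∃ h ∈ H₁, h * e ∈ X := by
    by_contra! hcon
    have hrad : P₁ ≤ rad X := le_rad_of_mul_mem hP₁ hXA fun y hy =>
      hXA.mul_mem_of_notMem he hH₁ hy (hd y hy) fun hc =>
        hcon _ hc (by rwa [he.mul_mul_cancel])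
    obtain ⟨a, ha, b, hb, rfl⟩ := Subgroup.mem_sup.1 hxU
    have := mem_rad.1 (hrad (P₁.inv_mem hb)) _ hx
    rw [mul_comm, mul_inv_cancel_right] at this
    exact hd a this ha
  obtain ⟨R, hR, hhR⟩ := A.exists_basicSet h
  exact ⟨R, ⟨hR, hH₁.prop.1.subset hR hhR hh⟩, eq_mul_diff he hH₁ hP₁ hX hR hh hhR hhX⟩

theorem inf_le_rad_mul_diff (R : Set G) (K L : Subgroup G) :
    K ⊓ L ≤ rad (R * ((L : Set G) \ K)) := by
  intro d hd
  rw [mem_rad]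
  rintro _ ⟨r, hr, x, hx, rfl⟩
  refine ⟨r, hr, d * x, ⟨L.mul_mem hd.2 hx.1, fun h => hx.2 ?_⟩, mul_left_comm _ _ _⟩
  exact (K.mul_mem_cancel_left hd.1).1 h

/-! ### Star, wreath and tensor decompositions. -/

theorem isStarProduct_of_sup_eq_top (he : IsOddComplement H e)
    (hH₁ : Maximal (fun K : Subgroup G => A.IsASubgroup K ∧ K ≤ H) H₁)
    (hP₁ : IsLeast {K : Subgroup G | A.IsASubgroup K ∧ e ∈ K} P₁) (htop : H₁ ⊔ P₁ = ⊤) :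
    A.IsStarProduct H₁ P₁ where
  isASubgroup_left := hH₁.prop.1
  isASubgroup_right := hP₁.1.1
  normal := inferInstance
  le_rad X hX := by
    obtain ⟨x, hx⟩ := nonempty_of_mem_basicSets hX.1
    obtain ⟨R, -, rfl⟩ := exists_eq_mul_diff he hH₁ hP₁ hX.1 hx (htop ▸ Subgroup.mem_top x)
      (hX.2 hx).2
    exact inf_le_rad_mul_diff R H₁ P₁
  eq_mul X hX := by
    obtain ⟨x, hx⟩ := nonempty_of_mem_basicSets hX.1
    obtain ⟨R, hR, rfl⟩ := exists_eq_mul_diff he hH₁ hP₁ hX.1 hx (htop ▸ Subgroup.mem_top x)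
      fun h => hX.2 hx (Or.inl h)
    exact ⟨R, hR, _, ⟨diff_mem_basicSets he hH₁ hP₁, Set.sdiff_subset⟩, rfl⟩

theorem isWreathProduct_sup (he : IsOddComplement H e)
    (hH₁ : Maximal (fun K : Subgroup G => A.IsASubgroup K ∧ K ≤ H) H₁)
    (hP₁ : IsLeast {K : Subgroup G | A.IsASubgroup K ∧ e ∈ K} P₁) :
    A.IsWreathProduct (H₁ ⊔ P₁) P₁ where
  isASubgroup_top := hH₁.prop.1.sup hP₁.1.1
  isASubgroup_bot := hP₁.1.1
  le := le_sup_right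
  normal := inferInstance
  le_rad X hX := by
    have hXA := isASet_of_mem_basicSets hX.1
    refine le_rad_of_mul_mem hP₁ hXA fun x hx => hXA.mul_mem_of_notMem he hH₁ hx ?_ ?_
    · exact fun h => hX.2 hx (Subgroup.mem_sup_left h)
    · exact fun h => hX.2 hx ((mul_mem_cancel_right (Subgroup.mem_sup_right hP₁.1.2)).1
        (Subgroup.mem_sup_left h))

theorem isWreathProduct_inf (he : IsOddComplement H e)
    (hH₁ : Maximal (fun K : Subgroup G => A.IsASubgroup K ∧ K ≤ H) H₁)
    (hP₁ : IsLeast {K : Subgroup G | A.IsASubgroup K ∧ e ∈ K} P₁) :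
    A.IsWreathProduct H₁ (H₁ ⊓ P₁) where
  isASubgroup_top := hH₁.prop.1
  isASubgroup_bot := hH₁.prop.1.inf hP₁.1.1
  le := inf_le_left
  normal := inferInstance
  le_rad X hX := by
    obtain ⟨x, hx⟩ := nonempty_of_mem_basicSets hX.1
    have hU := hH₁.prop.1.sup hP₁.1.1
    by_cases hxU : x ∈ H₁ ⊔ P₁
    · obtain ⟨R, -, rfl⟩ := exists_eq_mul_diff he hH₁ hP₁ hX.1 hx hxU (hX.2 hx)
      exact inf_le_rad_mul_diff R H₁ P₁
    · exact inf_le_right.trans ((isWreathProduct_sup he hH₁ hP₁).le_rad X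
        ⟨hX.1, fun y hy hyU => hxU (hU.subset hX.1 hy hyU hx)⟩)

/-- With trivial intersection, the basic sets in `P₁` are just `{1}` and `P₁ \ H₁`, and multiplying
by them gives the basic sets inside and outside `H₁` respectively. -/
theorem isTensorProduct_restrict (he : IsOddComplement H e)
    (hH₁ : Maximal (fun K : Subgroup G => A.IsASubgroup K ∧ K ≤ H) H₁)
    (hP₁ : IsLeast {K : Subgroup G | A.IsASubgroup K ∧ e ∈ K} P₁) (hbot : H₁ ⊓ P₁ = ⊥)
    (hU : A.IsASubgroup (H₁ ⊔ P₁)) :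
    (A.restrict (H₁ ⊔ P₁) hU).IsTensorProduct (P₁.subgroupOf (H₁ ⊔ P₁))
      (H₁.subgroupOf (H₁ ⊔ P₁)) where
  isASubgroup_left := IsASubgroup.subgroupOf hU hP₁.1.1
  isASubgroup_right := IsASubgroup.subgroupOf hU hH₁.prop.1
  isCompl := by
    constructor
    · rw [disjoint_iff, Subgroup.subgroupOf, Subgroup.subgroupOf, ← Subgroup.comap_inf, inf_comm,
        hbot]
      exact Subgroup.bot_subgroupOf _
    · rw [codisjoint_iff, ← Subgroup.subgroupOf_sup le_sup_right le_sup_left, sup_comm,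
        Subgroup.subgroupOf_self]
  commute u _ v _ := Commute.all u v
  basicSets_eq := by
    have himage : ∀ R S : Set ↥(H₁ ⊔ P₁), ((↑) '' (R * S) : Set G) = (↑) '' R * (↑) '' S :=
      fun R S => Set.image_mul (H₁ ⊔ P₁).subtype
    have hpre : ∀ T : Set G, T ⊆ (H₁ ⊔ P₁ : Subgroup G) →
        ((↑) '' ((↑) ⁻¹' T : Set ↥(H₁ ⊔ P₁)) : Set G) = T := fun T hT => by
      rw [Set.image_preimage_eq_iff]
      simpa using hT
    have hHU : (H₁ : Set G) ⊆ (H₁ ⊔ P₁ : Subgroup G) := fun x hx => Subgroup.mem_sup_left hx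
    have hPU : (P₁ : Set G) \ H₁ ⊆ (H₁ ⊔ P₁ : Subgroup G) := fun x hx =>
      Subgroup.mem_sup_right hx.1
    ext Y
    constructor
    · intro hY
      obtain ⟨y, hy⟩ := nonempty_of_mem_basicSets hY
      by_cases hyH : (y : G) ∈ H₁
      · refine ⟨{1}, ⟨(A.restrict _ hU).one_mem, by simp⟩, Y, ⟨hY, ?_⟩, by simp⟩
        exact (IsASubgroup.subgroupOf hU hH₁.prop.1).subset hY hy hyH
      · obtain ⟨R, hR, hYR⟩ := exists_eq_mul_diff he hH₁ hP₁ hY ⟨y, hy, rfl⟩ y.2 hyH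
        refine ⟨(↑) ⁻¹' ((P₁ : Set G) \ H₁), ⟨?_, fun z hz => hz.1⟩, (↑) ⁻¹' R,
          ⟨?_, fun z hz => hR.2 (Set.mem_preimage.1 hz)⟩, ?_⟩
        · change (_ '' _ : Set G) ∈ A.basicSets
          rw [hpre _ hPU]
          exact diff_mem_basicSets he hH₁ hP₁
        · change (_ '' _ : Set G) ∈ A.basicSets
          rw [hpre _ (hR.2.trans hHU)]
          exact hR.1
        · refine Set.image_injective.2 Subtype.val_injective ?_
          rw [himage, hpre _ hPU, hpre _ (hR.2.trans hHU), hYR, mul_comm]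
    · rintro ⟨R, ⟨hR, hRP⟩, S, ⟨hS, hSH⟩, rfl⟩
      obtain ⟨r, hr⟩ := nonempty_of_mem_basicSets hR
      have hSH' : ((↑) '' S : Set G) ⊆ H₁ := by
        rintro _ ⟨s, hs, rfl⟩
        exact hSH hs
      change (_ '' _ : Set G) ∈ A.basicSets
      rw [himage]
      by_cases hrH : (r : G) ∈ H₁
      · have hr1 : (r : G) = 1 := by
          rw [← Subgroup.mem_bot, ← hbot]
          exact ⟨hrH, hRP hr⟩
        have : ((↑) '' R : Set G) = {1} := eq_of_mem_basicSets hR A.one_mem ⟨r, hr, rfl⟩ hr1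
        rw [this, Set.singleton_one, one_mul]
        exact hS
      · have : ((↑) '' R : Set G) = (P₁ : Set G) \ H₁ :=
          eq_of_mem_basicSets hR (diff_mem_basicSets he hH₁ hP₁) ⟨r, hr, rfl⟩ ⟨hRP hr, hrH⟩
        rw [this, mul_comm]
        exact mul_diff_mem_basicSets he hH₁ hP₁ ⟨hS, hSH'⟩

theorem eq_trivial_of_eq_bot_of_eq_top (he : IsOddComplement H e)
    (hH₁ : Maximal (fun K : Subgroup G => A.IsASubgroup K ∧ K ≤ H) H₁)
    (hP₁ : IsLeast {K : Subgroup G | A.IsASubgroup K ∧ e ∈ K} P₁) (hbot : H₁ = ⊥)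
    (htop : P₁ = ⊤) : A = SchurRing.trivial G := by
  have := diff_mem_basicSets he hH₁ hP₁
  rw [hbot, htop, Subgroup.coe_top, Subgroup.coe_bot, ← Set.compl_eq_univ_sdiff] at this
  exact eq_trivial_of_compl_one_mem this

theorem star_or_wreath (he : IsOddComplement H e)
    (hH₁ : Maximal (fun K : Subgroup G => A.IsASubgroup K ∧ K ≤ H) H₁)
    (hP₁ : IsLeast {K : Subgroup G | A.IsASubgroup K ∧ e ∈ K} P₁)
    (hA : A ≠ SchurRing.trivial G) :
    (H₁ ⊔ P₁ = ⊤ ∧ 1 < Nat.card H₁ ∧ A.IsStarProduct H₁ P₁) ∨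
    (A.IsNontrivialWreathProduct (H₁ ⊔ P₁) P₁ ∧
      ∃ h : A.IsASubgroup (H₁ ⊔ P₁),
        (A.restrict (H₁ ⊔ P₁) h).IsTensorComplemented (P₁.subgroupOf (H₁ ⊔ P₁))) ∨
    (A.IsNontrivialWreathProduct (H₁ ⊔ P₁) P₁ ∧
      A.IsNontrivialWreathProduct H₁ (H₁ ⊓ P₁)) := by
  by_cases htop : H₁ ⊔ P₁ = ⊤
  · refine Or.inl ⟨htop, ?_, isStarProduct_of_sup_eq_top he hH₁ hP₁ htop⟩
    rw [Subgroup.one_lt_card_iff_ne_bot]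
    rintro rfl
    exact hA (eq_trivial_of_eq_bot_of_eq_top he hH₁ hP₁ rfl (by rwa [bot_sup_eq] at htop))
  right
  have hwr : A.IsNontrivialWreathProduct (H₁ ⊔ P₁) P₁ :=
    { isWreathProduct_sup he hH₁ hP₁ with
      ne_bot := by
        rintro rfl
        exact he.notMem (Subgroup.mem_bot.1 hP₁.1.2 ▸ H.one_mem)
      ne_top := htop }
  by_cases hbot : H₁ ⊓ P₁ = ⊥
  · exact Or.inl ⟨hwr, hH₁.prop.1.sup hP₁.1.1, _, isTensorProduct_restrict he hH₁ hP₁ hbot _⟩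
  · refine Or.inr ⟨hwr, { isWreathProduct_inf he hH₁ hP₁ with ne_bot := hbot, ne_top := ?_ }⟩
    rintro rfl
    exact htop (top_sup_eq _)

end Maximal

/-- In a group of order twice an odd number, a subgroup of odd order and `2`-power index together
with a subgroup of order `2` gives an `IsOddComplement`. -/
theorem exists_isOddComplement {H P : Subgroup G} {n : ℕ} (hn : Odd n) (hG : Nat.card G = 2 * n)
    (hH : Odd (Nat.card H)) (hH_index : ∃ m : ℕ, H.index = 2 ^ m) (hP : Nat.card P = 2) :
    ∃ e, IsOddComplement H e ∧ ∀ K : Subgroup G, P ≤ K ↔ e ∈ K := by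
  obtain ⟨m, hm⟩ := hH_index
  have hmul := H.card_mul_index
  rw [hG, hm] at hmul
  -- `m = 0` would make `|H|` even, and `m ≥ 2` would make `n` even.
  have hm1 : m = 1 := by
    rcases m with _ | _ | m
    · rw [pow_zero, mul_one] at hmul
      exact absurd hH (by rw [hmul]; simp)
    · rfl
    · refine absurd hn (Nat.not_odd_iff_even.2 ⟨Nat.card H * 2 ^ m, ?_⟩)
      rw [pow_succ, pow_succ] at hmul
      linarith
  obtain ⟨e, he, heP⟩ : ∃ e ∈ P, e ≠ 1 :=
    P.bot_or_exists_ne_one.resolve_left fun h => by simp [h] at hP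
  have hee : e ^ 2 = 1 := hP ▸ pow_card_eq_one_of_mem he
  refine ⟨e, ⟨hH, by rw [hm, hm1, pow_one], by rwa [← pow_two], fun h => heP ?_⟩, fun K =>
    ⟨fun h => h he, fun h => ?_⟩⟩
  · exact eq_of_sq_eq_of_odd_card hH h H.one_mem (by rw [hee, one_pow])
  · have : P = Subgroup.zpowers e := by
      refine (Subgroup.eq_of_le_of_card_ge ((Subgroup.zpowers_le).2 he) ?_).symm
      rw [hP, Nat.card_zpowers, orderOf_eq_prime hee heP]
    rw [this, Subgroup.zpowers_le]
    exact h

end SchurRing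

end

theorem mainTheorem6 {G : Type*} [CommGroup G] [Finite G]
    (hG : (∃ k : ℕ, 1 ≤ k ∧
        Nonempty (G ≃* Multiplicative (ZMod 6) × Multiplicative (ZMod (3 ^ k)))) ∨
      (∃ q : ℕ, q.Prime ∧ Odd q ∧
        Nonempty (G ≃* (Multiplicative (ZMod 3) × Multiplicative (ZMod 3)) ×
          Multiplicative (ZMod (2 * q)))))
    (H P : Subgroup G) (hH_card : Odd (Nat.card H)) (hH_index : ∃ m : ℕ, H.index = 2 ^ m)
    (hP : Nat.card P = 2)
    (A : SchurRing G) (hA : A ≠ SchurRing.trivial G)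
    (H₁ : Subgroup G) (hH₁ : Maximal (fun K : Subgroup G => A.IsASubgroup K ∧ K ≤ H) H₁)
    (P₁ : Subgroup G) (hP₁ : IsLeast {K : Subgroup G | A.IsASubgroup K ∧ P ≤ K} P₁) :
    (H₁ ⊔ P₁ = ⊤ ∧ 1 < Nat.card H₁ ∧ A.IsStarProduct H₁ P₁) ∨
    (1 < Nat.card H₁ ∧ A.IsWreathProduct H₁ H₁ ∧
      A.quotient H₁ hH₁.prop.1 = SchurRing.trivial (G ⧸ H₁)) ∨
    (A.IsNontrivialWreathProduct (H₁ ⊔ P₁) P₁ ∧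
      ∃ h : A.IsASubgroup (H₁ ⊔ P₁),
        (A.restrict (H₁ ⊔ P₁) h).IsTensorComplemented (P₁.subgroupOf (H₁ ⊔ P₁))) ∨
    (A.IsNontrivialWreathProduct (H₁ ⊔ P₁) P₁ ∧
      A.IsNontrivialWreathProduct H₁ (H₁ ⊓ P₁)) := by
  obtain ⟨n, hn, hcard⟩ : ∃ n, Odd n ∧ Nat.card G = 2 * n := by
    rcases hG with ⟨k, -, ⟨f⟩⟩ | ⟨q, -, hq, ⟨f⟩⟩
    · refine ⟨3 * 3 ^ k, (by decide : Odd 3).mul ((by decide : Odd 3).pow), ?_⟩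
      rw [Nat.card_congr f.toEquiv, Nat.card_prod, Nat.card_congr Multiplicative.toAdd,
        Nat.card_congr Multiplicative.toAdd, Nat.card_zmod, Nat.card_zmod]
      ring
    · refine ⟨9 * q, (by decide : Odd 9).mul hq, ?_⟩
      rw [Nat.card_congr f.toEquiv, Nat.card_prod, Nat.card_prod,
        Nat.card_congr Multiplicative.toAdd, Nat.card_congr Multiplicative.toAdd, Nat.card_zmod,
        Nat.card_zmod]
      ring
  obtain ⟨e, he, heP⟩ := SchurRing.exists_isOddComplement hn hcard hH_card hH_index hP
  simp only [heP] at hP₁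
  -- The first, third and fourth alternatives already cover every case.
  exact (SchurRing.star_or_wreath he hH₁ hP₁ hA).imp_right Or.inr
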